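/- For $x \in \mathbb{R}^n$ let $\|x\|_1=\sum_i|x_i|$ and let $\|x\|_2$ be the Euclidean norm. Let $x^\ast\in\mathbb{R}^n$ have exactly $s\ge 1$ non-zero entries, and let $\mathcal{C}_1$ be the prior restricted cone at $x^\ast$ of the program $$\min_x \|x\|_1 \quad\text{subject to}\quad y=Ax,\ \ \|x\|_2\le\|x^\ast\|_2, \qquad\text{where } y=Ax^\ast,$$ that is, $$\mathcal{C}_1=\{u\in\mathbb{R}^n:\ \exists\, t>0,\ \|x^\ast+tu\|_1\le\|x^\ast\|_1 \text{ and } \|x^\ast+tu\|_2\le\|x^\ast\|_2\}.$$ For a convex cone $K\subseteq\mathbb{R}^n$ let $\delta(K)=\mathbb{E}\big(\sup_{t\in K,\,\|t\|_2\le 1}\langle g,t\rangle\big)^2$, with $g\sim N(0,I_n)$, be its statistical dimension. Put $\varphi(u)=\sqrt{2/\pi}\,e^{-u^2/2}$ and, for $\rho\in[0,1]$, $$\psi_1(\rho)=\inf_{\tau\ge 0}\Big\{\rho(1+\tau^2)+(1-\rho)\int_\tau^\infty (u-\tau)^2\varphi(u)\,du\Big\}.$$ Then $$\psi_1(s/n)-\frac{2}{\sqrt{sn}}-\frac{1}{2n}\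 \le\ \frac{\delta(\mathcal{C}_1)}{n}\ \le\ \psi_1(s/n).$$ Moreover $\psi_1$ maps $[0,1]$ into $[0,1]$. For every $\rho\in(0,1]$ the infimum defining $\psi_1(\rho)$ is attained at a unique $\tau\ge 0$. If $0<\rho<1$, this $\tau$ is positive and is the unique solution in $(0,\infty)$ of the stationary equation $$\frac{\rho}{1-\rho}=\int_\tau^\infty\Big(\frac{u}{\tau}-1\Big)\varphi(u)\,du.$$ -/

import Mathlib

noncomputable section

/-- The prior restricted set at the true signal `x` of the program
`min f 0 z` subject to `y = A z` and `f i z ≤ f i x` for `1 ≤ i ≤ k`. -/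
def priorRestrictedSet {n k : ℕ} (f : Fin (k + 1) → EuclideanSpace ℝ (Fin n) → EReal)
    (x : EuclideanSpace ℝ (Fin n)) : Set (EuclideanSpace ℝ (Fin n)) :=
  {d | ∀ i, f i (x + d) ≤ f i x}

/-- The prior restricted cone: all `u` with a positive multiple in the prior restricted set. -/
def priorRestrictedCone {n k : ℕ} (f : Fin (k + 1) → EuclideanSpace ℝ (Fin n) → EReal)
    (x : EuclideanSpace ℝ (Fin n)) : Set (EuclideanSpace ℝ (Fin n)) :=
  {u | ∃ t : ℝ, 0 < t ∧ t • u ∈ priorRestrictedSet f x}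

/-- The statistical dimension `E (sup_{t ∈ K, ‖t‖ ≤ 1} ⟨g, t⟩) ^ 2`, where `g` is a standard
Gaussian vector. For a cone `K` (so `0 ∈ K`) the supremum is over a non-empty set that is
bounded above by `‖g‖`. -/
def statisticalDimension {n : ℕ} (K : Set (EuclideanSpace ℝ (Fin n))) : ℝ :=
  ∫ g, (sSup ((fun t => inner ℝ g t) '' (K ∩ Metric.closedBall 0 1))) ^ 2
    ∂(ProbabilityTheory.stdGaussian (EuclideanSpace ℝ (Fin n)))

/-- The functions of the program `min ‖z‖₁` subject to `y = A z` and `‖z‖₂ ≤ ‖x‖₂`: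
the `ℓ₁` norm is the objective, the `ℓ₂` norm is the single additional prior. -/
def l1BoundedNormProgram (n : ℕ) : Fin (1 + 1) → EuclideanSpace ℝ (Fin n) → EReal :=
  ![fun z => ((∑ i, |z i| : ℝ) : EReal), fun z => ((‖z‖ : ℝ) : EReal)]

/-- The density of the absolute value of a standard normal variable. -/
def halfNormalDensity (u : ℝ) : ℝ :=
  √(2 / Real.pi) * Real.exp (-u ^ 2 / 2)

/-- The function of `τ` whose infimum over `τ ≥ 0` is `ψ₁(ρ)`. -/
def psi1Objective (ρ τ : ℝ) : ℝ :=
  ρ * (1 + τ ^ 2) + (1 - ρ) * ∫ u in Set.Ioi τ, (u - τ) ^ 2 * halfNormalDensity u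

/-- The curve `ψ₁(ρ)`, used for `0 ≤ ρ ≤ 1`. -/
def psi1 (ρ : ℝ) : ℝ :=
  sInf (psi1Objective ρ '' Set.Ici 0)

/-- The stationary equation, for `τ > 0` and `0 < ρ < 1`. -/
def Psi1Stationary (ρ τ : ℝ) : Prop :=
  ρ / (1 - ρ) = ∫ u in Set.Ioi τ, (u / τ - 1) * halfNormalDensity u

end

open MeasureTheory ProbabilityTheory Filter Topology

/-! Upper bound: every `u` in the cone has nonpositive ℓ₁ directional derivative at `x`. Subtracting
from `g` its projection to `τ ∂‖x‖₁` leaves a vector `w` with `⟨g, u⟩ ≤ ⟨w, u⟩` on the cone, so the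
squared support function is at most `‖w‖²` (`supportFun_sq_le`). The expectation of `‖w‖²` is `n *
psi1Objective (s / n) τ`; the ℓ₂ constraint plays no part here.

Lower bound: up to closure the cone contains the ℓ₁ descent directions with `⟨x, u⟩ ≤ 0`. For each
`g` the optimal random parameter `σ` makes `w` such a descent direction with `⟨g, w⟩ = ‖w‖²`. Two
losses occur (`supportFun_sq_ge`). Moving `w` into the half-space costs the squared positive part of
one Gaussian coordinate, at most `1 / 2` in mean. Replacing `σ` by the deterministic minimiser `τ`
costs the squared sum of residuals over `s`, by strong convexity in the parameter. Stationarity of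
`τ` centres that sum, so its second moment is a variance, and the cost is at most `2√(n/s)`
(`variance_bound`).

The claims on `ψ₁` follow from the strong convexity inequality `psi1Objective_ge` at a stationary
point. -/

/-! ### Gaussian excess moments and the minimiser of `ψ₁`. -/

/-- The `k`-th moment of the excess of `|u|` over `τ`, for a standard normal `u`. -/
noncomputable def excessMoment (k : ℕ) (τ : ℝ) : ℝ :=
  ∫ u, max (|u| - τ) 0 ^ k ∂gaussianReal 0 1

theorem memLp_excess (τ : ℝ) : MemLp (fun u : ℝ => max (|u| - τ) 0) 2 (gaussianReal 0 1) :=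
  ((memLp_id_gaussianReal 2).abs.sub (memLp_const τ)).pos_part

theorem integrable_excess (τ : ℝ) :
    Integrable (fun u : ℝ => max (|u| - τ) 0) (gaussianReal 0 1) :=
  (memLp_excess τ).integrable (by norm_num)

theorem integrable_excess_sq (τ : ℝ) :
    Integrable (fun u : ℝ => max (|u| - τ) 0 ^ 2) (gaussianReal 0 1) :=
  (memLp_excess τ).integrable_sq

theorem excessMoment_one (τ : ℝ) :
    excessMoment 1 τ = ∫ u, max (|u| - τ) 0 ∂gaussianReal 0 1 := by
  simp [excessMoment]

theorem excessMoment_nonneg (k : ℕ) (τ : ℝ) : 0 ≤ excessMoment k τ :=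
  integral_nonneg fun _ => by positivity

theorem halfNormalDensity_eq (u : ℝ) : halfNormalDensity u = 2 * gaussianPDFReal 0 1 u := by
  have h : √(2 / Real.pi) = 2 * (√(2 * Real.pi))⁻¹ := by
    rw [Real.sqrt_div (by norm_num), Real.sqrt_mul (by norm_num)]
    have := Real.sqrt_pos.2 Real.pi_pos
    field_simp
    norm_num
  simp [halfNormalDensity, gaussianPDFReal_def, h, mul_assoc]

theorem integral_comp_abs_gaussianReal (f : ℝ → ℝ) :
    ∫ u, f |u| ∂gaussianReal 0 1 = ∫ u in Set.Ioi 0, f u * halfNormalDensity u := by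
  rw [integral_gaussianReal_eq_integral_smul one_ne_zero]
  have h := integral_comp_abs (f := fun u => gaussianPDFReal 0 1 u * f u)
  have h' : ∀ u : ℝ, gaussianPDFReal 0 1 |u| = gaussianPDFReal 0 1 u := fun u => by
    simp [gaussianPDFReal_def]
  simp only [h'] at h
  simp only [smul_eq_mul]
  rw [h, ← integral_const_mul]
  congr 1; ext u; rw [halfNormalDensity_eq]; ring

theorem excessMoment_eq_setIntegral {k : ℕ} (hk : k ≠ 0) {τ : ℝ} (hτ : 0 ≤ τ) :
    excessMoment k τ = ∫ u in Set.Ioi τ, (u - τ) ^ k * halfNormalDensity u := by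
  rw [excessMoment, integral_comp_abs_gaussianReal (fun u => max (u - τ) 0 ^ k),
    ← integral_indicator measurableSet_Ioi, ← integral_indicator measurableSet_Ioi]
  congr 1; ext u
  by_cases h : τ < u
  · simp [Set.indicator, h, hτ.trans_lt h, max_eq_left (sub_nonneg.2 h.le)]
  · simp [Set.indicator, h, max_eq_right (sub_nonpos.2 (not_lt.1 h)), hk]

theorem psi1Objective_eq (ρ : ℝ) {τ : ℝ} (hτ : 0 ≤ τ) :
    psi1Objective ρ τ = ρ * (1 + τ ^ 2) + (1 - ρ) * excessMoment 2 τ := by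
  rw [psi1Objective, excessMoment_eq_setIntegral two_ne_zero hτ]

theorem integral_sq_gaussianReal : ∫ u, u ^ 2 ∂gaussianReal 0 1 = 1 := by
  have h := variance_eq_sub (memLp_id_gaussianReal (μ := 0) (v := 1) 2)
  simpa [integral_id_gaussianReal] using h.symm

theorem excessMoment_two_zero : excessMoment 2 0 = 1 := by
  simp [excessMoment, integral_sq_gaussianReal]

theorem max_sub_le_max_sub (a : ℝ) {τ τ' : ℝ} (h : τ ≤ τ') : max (a - τ') 0 ≤ max (a - τ) 0 :=
  max_le_max (by linarith) le_rfl

theorem excessMoment_anti (k : ℕ) (hk : k ≤ 2) : Antitone (excessMoment k) := by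
  intro τ τ' h
  have hi : ∀ τ, Integrable (fun u : ℝ => max (|u| - τ) 0 ^ k) (gaussianReal 0 1) := by
    intro τ
    interval_cases k
    · simp
    · simpa using integrable_excess τ
    · exact integrable_excess_sq τ
  exact integral_mono (hi τ') (hi τ) fun u =>
    pow_le_pow_left₀ (le_max_right _ _) (max_sub_le_max_sub _ h) k

theorem excessMoment_two_le_one {τ : ℝ} (hτ : 0 ≤ τ) : excessMoment 2 τ ≤ 1 :=
  excessMoment_two_zero ▸ excessMoment_anti 2 le_rfl hτ

theorem continuous_excessMoment_one : Continuous (excessMoment 1) := by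
  refine (LipschitzWith.of_le_add (f := excessMoment 1) fun τ τ' => ?_).continuous
  rw [excessMoment_one, excessMoment_one, Real.dist_eq]
  have : ∫ u, (max (|u| - τ') 0 + |τ - τ'|) ∂gaussianReal 0 1
      = (∫ u, max (|u| - τ') 0 ∂gaussianReal 0 1) + |τ - τ'| := by
    rw [integral_add (integrable_excess τ') (integrable_const _)]; simp
  rw [← this]
  refine integral_mono (integrable_excess τ)
    ((integrable_excess τ').add (integrable_const _)) fun u => ?_
  refine max_le ?_ (by positivity)
  have := neg_abs_le (τ - τ')
  linarith [le_max_left (|u| - τ') 0]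

/-- A zero mean of `|u|` would force `u = 0` almost everywhere, against the second moment `1`. -/
theorem excessMoment_one_zero_pos : 0 < excessMoment 1 0 := by
  refine (excessMoment_nonneg 1 0).lt_of_ne fun h => ?_
  rw [excessMoment_one, eq_comm, integral_eq_zero_iff_of_nonneg
    (f := fun u : ℝ => max (|u| - 0) 0) (fun u => le_max_right _ _) (integrable_excess 0)] at h
  have h2 : ∫ u, u ^ 2 ∂gaussianReal 0 1 = ∫ _u, (0 : ℝ) ∂gaussianReal 0 1 := by
    refine integral_congr_ae ?_
    filter_upwards [h] with u hu
    have : u = 0 := by simpa using hu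
    simp [this]
  rw [integral_sq_gaussianReal] at h2
  simp at h2

/-- The tangent inequality for the square of the positive part. -/
theorem max_sub_sq_ge (a τ τ' : ℝ) :
    max (a - τ) 0 ^ 2 - 2 * max (a - τ) 0 * (τ' - τ) ≤ max (a - τ') 0 ^ 2 := by
  rcases le_total (a - τ) 0 with h | h <;> rcases le_total (a - τ') 0 with h' | h' <;>
    simp only [max_eq_left, max_eq_right, h, h'] <;> nlinarith [sq_nonneg (τ' - τ)]

theorem excessMoment_two_ge (τ τ' : ℝ) :
    excessMoment 2 τ - 2 * excessMoment 1 τ * (τ' - τ) ≤ excessMoment 2 τ' := by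
  have h : ∫ u, (max (|u| - τ) 0 ^ 2 - 2 * max (|u| - τ) 0 * (τ' - τ)) ∂gaussianReal 0 1
      = excessMoment 2 τ - 2 * excessMoment 1 τ * (τ' - τ) := by
    rw [integral_sub (integrable_excess_sq τ) (((integrable_excess τ).const_mul 2).mul_const _),
      integral_mul_const, integral_const_mul, excessMoment_one, excessMoment]
  rw [← h]
  exact integral_mono ((integrable_excess_sq τ).sub
    (((integrable_excess τ).const_mul 2).mul_const _)) (integrable_excess_sq τ')
    fun u => max_sub_sq_ge _ _ _

/-- A continuous function that becomes nonpositive on `[0, ∞)` has a complementary point. -/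
theorem exists_complementary_point {h : ℝ → ℝ} (hc : Continuous h) {T : ℝ} (hT : 0 ≤ T)
    (hneg : h T ≤ 0) : ∃ τ, 0 ≤ τ ∧ h τ ≤ 0 ∧ τ * h τ = 0 := by
  rcases le_total (h 0) 0 with h0 | h0
  · exact ⟨0, le_rfl, h0, by simp⟩
  · obtain ⟨τ, hτ, h1⟩ := intermediate_value_Icc' hT hc.continuousOn ⟨hneg, h0⟩
    exact ⟨τ, hτ.1, h1.le, by simp [h1]⟩

/-- This denominator-free form of the stationary equation also covers `ρ = 1`, where `τ = 0`. For `ρ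
< 1` the point `0` is excluded because the first moment there is positive. -/
theorem exists_stationary {ρ : ℝ} (hρ : ρ ∈ Set.Ioc (0 : ℝ) 1) :
    ∃ τ, 0 ≤ τ ∧ ρ * τ = (1 - ρ) * excessMoment 1 τ ∧ (ρ < 1 → 0 < τ) := by
  obtain ⟨h0, h1⟩ := hρ
  -- At this `T`, monotonicity gives `(1 - ρ) * excessMoment 1 T ≤ excessMoment 1 0 = ρ * T`.
  have hT : 0 ≤ excessMoment 1 0 / ρ := div_nonneg (excessMoment_nonneg _ _) h0.le
  have hc : Continuous fun τ => (1 - ρ) * excessMoment 1 τ - ρ * τ :=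
    (continuous_const.mul continuous_excessMoment_one).sub (continuous_const.mul continuous_id)
  obtain ⟨τ, hτ, hn, hm⟩ := exists_complementary_point hc hT (by
    have h2 := excessMoment_anti 1 (by norm_num) hT
    have h3 := excessMoment_nonneg 1 (excessMoment 1 0 / ρ)
    have h4 : ρ * (excessMoment 1 0 / ρ) = excessMoment 1 0 := by field_simp
    rw [h4]
    nlinarith)
  rcases hτ.eq_or_lt with rfl | hpos
  · have h5 := excessMoment_one_zero_pos
    have : ρ = 1 := by
      refine le_antisymm h1 (not_lt.1 fun hlt => ?_)
      have : 0 < (1 - ρ) * excessMoment 1 0 := mul_pos (by linarith) h5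
      linarith
    exact ⟨0, le_rfl, by simp [this], fun h => absurd h (by simp [this])⟩
  · refine ⟨τ, hτ, ?_, fun _ => hpos⟩
    have := (mul_eq_zero.1 hm).resolve_left hpos.ne'
    linarith

/-- Stationarity cancels the linear term of the tangent inequality against that of `ρ * τ' ^ 2`. The
surviving square gives minimality and, for `ρ > 0`, uniqueness. -/
theorem psi1Objective_ge {ρ τ τ' : ℝ} (hρ : ρ ≤ 1) (hτ : 0 ≤ τ) (hτ' : 0 ≤ τ')
    (h : ρ * τ = (1 - ρ) * excessMoment 1 τ) :
    psi1Objective ρ τ + ρ * (τ' - τ) ^ 2 ≤ psi1Objective ρ τ' := by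
  rw [psi1Objective_eq ρ hτ, psi1Objective_eq ρ hτ']
  have h1 := mul_le_mul_of_nonneg_left (excessMoment_two_ge τ τ') (sub_nonneg.2 hρ)
  have h2 : (1 - ρ) * (excessMoment 2 τ - 2 * excessMoment 1 τ * (τ' - τ))
      = (1 - ρ) * excessMoment 2 τ - 2 * (ρ * τ) * (τ' - τ) := by rw [h]; ring
  nlinarith

theorem psi1Objective_nonneg {ρ τ : ℝ} (hρ : ρ ∈ Set.Icc (0 : ℝ) 1) (hτ : 0 ≤ τ) :
    0 ≤ psi1Objective ρ τ := by
  rw [psi1Objective_eq ρ hτ]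
  have := excessMoment_nonneg 2 τ
  have := sub_nonneg.2 hρ.2
  have := hρ.1
  positivity

theorem bddBelow_psi1Objective {ρ : ℝ} (hρ : ρ ∈ Set.Icc (0 : ℝ) 1) :
    BddBelow (psi1Objective ρ '' Set.Ici 0) :=
  ⟨0, by rintro _ ⟨τ, hτ, rfl⟩; exact psi1Objective_nonneg hρ hτ⟩

theorem psi1_le {ρ τ : ℝ} (hρ : ρ ∈ Set.Icc (0 : ℝ) 1) (hτ : 0 ≤ τ) :
    psi1 ρ ≤ psi1Objective ρ τ :=
  csInf_le (bddBelow_psi1Objective hρ) ⟨τ, hτ, rfl⟩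

theorem le_psi1 {ρ c : ℝ} (h : ∀ τ, 0 ≤ τ → c ≤ psi1Objective ρ τ) : c ≤ psi1 ρ :=
  le_csInf ⟨_, 0, Set.self_mem_Ici, rfl⟩ (by rintro _ ⟨τ, hτ, rfl⟩; exact h τ hτ)

theorem psi1_mem_Icc {ρ : ℝ} (hρ : ρ ∈ Set.Icc (0 : ℝ) 1) : psi1 ρ ∈ Set.Icc (0 : ℝ) 1 := by
  refine ⟨le_psi1 fun τ hτ => psi1Objective_nonneg hρ hτ, (psi1_le hρ le_rfl).trans_eq ?_⟩
  rw [psi1Objective_eq ρ le_rfl, excessMoment_two_zero]; ring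

theorem psi1_eq_of_stationary {ρ τ : ℝ} (hρ : ρ ∈ Set.Icc (0 : ℝ) 1) (hτ : 0 ≤ τ)
    (h : ρ * τ = (1 - ρ) * excessMoment 1 τ) : psi1Objective ρ τ = psi1 ρ := by
  refine le_antisymm (le_psi1 fun τ' hτ' => ?_) (psi1_le hρ hτ)
  have := psi1Objective_ge hρ.2 hτ hτ' h
  nlinarith [mul_nonneg hρ.1 (sq_nonneg (τ' - τ))]

theorem psi1Stationary_iff {ρ τ : ℝ} (hρ : ρ < 1) (hτ : 0 < τ) :
    Psi1Stationary ρ τ ↔ ρ * τ = (1 - ρ) * excessMoment 1 τ := by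
  have h : ∫ u in Set.Ioi τ, (u / τ - 1) * halfNormalDensity u = τ⁻¹ * excessMoment 1 τ := by
    rw [excessMoment_eq_setIntegral one_ne_zero hτ.le, ← integral_const_mul]
    congr 1; ext u; field_simp
  have h1 : 1 - ρ ≠ 0 := by linarith
  rw [Psi1Stationary, h, ← div_eq_inv_mul, div_eq_div_iff h1 hτ.ne', mul_comm (excessMoment 1 τ)]

theorem psi1_minimizer {ρ : ℝ} (hρ : ρ ∈ Set.Ioc (0 : ℝ) 1) :
    ∃ τ : ℝ, 0 ≤ τ ∧ psi1Objective ρ τ = psi1 ρ ∧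
      (∀ τ' : ℝ, 0 ≤ τ' → psi1Objective ρ τ' = psi1 ρ → τ' = τ) ∧
      (ρ < 1 → 0 < τ ∧ Psi1Stationary ρ τ ∧
        ∀ τ' : ℝ, 0 < τ' → Psi1Stationary ρ τ' → τ' = τ) := by
  have hρ' : ρ ∈ Set.Icc (0 : ℝ) 1 := ⟨hρ.1.le, hρ.2⟩
  obtain ⟨τ, hτ, h, hpos⟩ := exists_stationary hρ
  have hmin := psi1_eq_of_stationary hρ' hτ h
  have huniq : ∀ τ' : ℝ, 0 ≤ τ' → psi1Objective ρ τ' = psi1 ρ → τ' = τ := by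
    intro τ' hτ' h'
    have h1 := psi1Objective_ge hρ.2 hτ hτ' h
    have h2 : ρ * (τ' - τ) ^ 2 ≤ 0 := by linarith
    have h3 : (τ' - τ) ^ 2 ≤ 0 := nonpos_of_mul_nonpos_right h2 hρ.1
    exact sub_eq_zero.1 (pow_eq_zero_iff two_ne_zero |>.1 (le_antisymm h3 (sq_nonneg _)))
  refine ⟨τ, hτ, hmin, huniq, fun h1 => ⟨hpos h1, (psi1Stationary_iff h1 (hpos h1)).2 h, ?_⟩⟩
  intro τ' hτ' hs
  exact huniq τ' hτ'.le (psi1_eq_of_stationary hρ' hτ'.le ((psi1Stationary_iff h1 hτ').1 hs))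

/-! ### A moment inequality by Gaussian integration by parts. -/

theorem hasDerivAt_halfNormalDensity (u : ℝ) :
    HasDerivAt halfNormalDensity (-u * halfNormalDensity u) u := by
  have h : HasDerivAt (fun u : ℝ => -u ^ 2 / 2) (-u) u := by
    refine ((hasDerivAt_pow 2 u).neg.div_const 2).congr_deriv ?_
    push_cast; ring
  refine (h.exp.const_mul (√(2 / Real.pi))).congr_deriv ?_
  rw [halfNormalDensity]; ring

theorem integrable_pow_mul_halfNormalDensity (k : ℕ) :
    Integrable fun u : ℝ => u ^ k * halfNormalDensity u := by
  have h := (integrable_rpow_mul_exp_neg_mul_sq (b := 1 / 2) (by norm_num) (s := k)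
    (by have : (0 : ℝ) ≤ k := Nat.cast_nonneg k
        linarith)).const_mul √(2 / Real.pi)
  refine h.congr (.of_forall fun u => ?_)
  simp only [halfNormalDensity, Real.rpow_natCast]
  ring_nf

/-- With `φ` the half-normal density, `(u - τ)² φ` vanishes at `τ` and at infinity. Integrating its
derivative shows that twice the first moment is `∫ (u - τ)² u φ`, and `u ≥ τ` on the domain. -/
theorem mul_excessMoment_two_le {τ : ℝ} (hτ : 0 ≤ τ) :
    τ * excessMoment 2 τ ≤ 2 * excessMoment 1 τ := by
  have i0 := integrable_pow_mul_halfNormalDensity 0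
  have i1 := integrable_pow_mul_halfNormalDensity 1
  have i2 := integrable_pow_mul_halfNormalDensity 2
  have i3 := integrable_pow_mul_halfNormalDensity 3
  have j1 : Integrable fun u : ℝ => (u - τ) * halfNormalDensity u :=
    (i1.sub (i0.const_mul τ)).congr (.of_forall fun u => by simp; ring)
  have j2 : Integrable fun u : ℝ => (u - τ) ^ 2 * halfNormalDensity u :=
    ((i2.sub (i1.const_mul (2 * τ))).add (i0.const_mul (τ ^ 2))).congr
      (.of_forall fun u => by simp; ring)
  have j3 : Integrable fun u : ℝ => (u - τ) ^ 2 * u * halfNormalDensity u :=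
    ((i3.sub (i2.const_mul (2 * τ))).add (i1.const_mul (τ ^ 2))).congr
      (.of_forall fun u => by simp; ring)
  have hd : ∀ u ∈ Set.Ici τ, HasDerivAt (fun u => (u - τ) ^ 2 * halfNormalDensity u)
      (2 * ((u - τ) * halfNormalDensity u) - (u - τ) ^ 2 * u * halfNormalDensity u) u := by
    intro u _
    refine ((((hasDerivAt_id u).sub_const τ).pow 2).mul
      (hasDerivAt_halfNormalDensity u)).congr_deriv ?_
    simp; ring
  have hI := integral_Ioi_of_hasDerivAt_of_tendsto' (a := τ) hd
    ((j1.const_mul 2).sub j3).integrableOn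
    (tendsto_zero_of_hasDerivAt_of_integrableOn_Ioi (a := τ) (fun u hu => hd u (Set.Ioi_subset_Ici_self hu))
      ((j1.const_mul 2).sub j3).integrableOn j2.integrableOn)
  rw [integral_sub (j1.const_mul 2).integrableOn j3.integrableOn, integral_const_mul] at hI
  have h1 := excessMoment_eq_setIntegral one_ne_zero hτ
  simp only [pow_one] at h1
  rw [← h1] at hI
  have hle : τ * excessMoment 2 τ ≤ ∫ u in Set.Ioi τ, (u - τ) ^ 2 * u * halfNormalDensity u := by
    rw [excessMoment_eq_setIntegral two_ne_zero hτ, ← integral_const_mul]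
    refine setIntegral_mono_on (j2.const_mul τ).integrableOn j3.integrableOn measurableSet_Ioi
      fun u hu => ?_
    have hu' : τ < u := hu
    have : 0 ≤ (u - τ) ^ 2 * halfNormalDensity u := by unfold halfNormalDensity; positivity
    nlinarith
  simp at hI
  linarith

/-! ### Scalar subdifferential calculus for the absolute value. -/

section AbsoluteValue

/-- The directional derivative of the absolute value at `x` in the direction `u`. -/
noncomputable def absDirDeriv (x u : ℝ) : ℝ :=
  if x = 0 then |u| else Real.sign x * u

/-- The signed distance of `a` from the scaled subdifferential of the absolute value at `x`. -/
noncomputable def subdiffResidual (x τ a : ℝ) : ℝ :=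
  if x = 0 then max (|a| - τ) 0 else Real.sign x * a - τ

/-- The difference of `a` and its projection to the scaled subdifferential of the absolute value
at `x`. -/
noncomputable def subdiffShrink (x τ a : ℝ) : ℝ :=
  if x = 0 then Real.sign a * max (|a| - τ) 0 else a - τ * Real.sign x

theorem sign_mul_sign_self {x : ℝ} (hx : x ≠ 0) : Real.sign x * Real.sign x = 1 := by
  rcases Real.sign_apply_eq_of_ne_zero x hx with h | h <;> simp [h]

theorem sign_mul_self_eq_abs (x : ℝ) : Real.sign x * x = |x| := by
  rcases lt_trichotomy x 0 with h | rfl | h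
  · simp [Real.sign_of_neg h, abs_of_neg h]
  · simp
  · simp [Real.sign_of_pos h, abs_of_pos h]

theorem sign_mul_le_abs (x u : ℝ) : Real.sign x * u ≤ |u| := by
  rcases Real.sign_apply_eq x with h | h | h <;> simp [h, le_abs_self, neg_le_abs]

theorem abs_add_absDirDeriv_le (x u : ℝ) : |x| + absDirDeriv x u ≤ |x + u| := by
  unfold absDirDeriv
  split_ifs with h
  · simp [h]
  · rw [← sign_mul_self_eq_abs x, ← mul_add]
    exact sign_mul_le_abs _ _

theorem abs_add_eq_of_abs_lt {x u : ℝ} (h : x ≠ 0 → |u| < |x|) :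
    |x + u| = |x| + absDirDeriv x u := by
  unfold absDirDeriv
  split_ifs with hx
  · simp [hx]
  · have h := abs_lt.1 (h hx)
    rcases lt_or_gt_of_ne hx with hn | hp
    · rw [abs_of_neg hn] at h ⊢
      rw [abs_of_neg (by linarith), Real.sign_of_neg hn]; ring
    · rw [abs_of_pos hp] at h ⊢
      rw [abs_of_pos (by linarith), Real.sign_of_pos hp]; ring

theorem absDirDeriv_mul (x u : ℝ) {t : ℝ} (ht : 0 ≤ t) :
    absDirDeriv x (t * u) = t * absDirDeriv x u := by
  unfold absDirDeriv
  split_ifs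
  · rw [abs_mul, abs_of_nonneg ht]
  · ring

theorem absDirDeriv_sub_mul {x y : ℝ} (h : x = 0 → y = 0) (u c : ℝ) :
    absDirDeriv x (u - c * y) = absDirDeriv x u - c * (Real.sign x * y) := by
  unfold absDirDeriv
  split_ifs with hx
  · simp [h hx]
  · ring

theorem sign_mul_le_absDirDeriv (x u : ℝ) : Real.sign x * u ≤ absDirDeriv x u := by
  unfold absDirDeriv
  split_ifs
  · exact sign_mul_le_abs _ _
  · exact le_rfl

theorem absDirDeriv_subdiffShrink {τ : ℝ} (hτ : 0 ≤ τ) (x a : ℝ) :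
    absDirDeriv x (subdiffShrink x τ a) = subdiffResidual x τ a := by
  unfold absDirDeriv subdiffShrink subdiffResidual
  split_ifs with hx
  · rcases eq_or_ne a 0 with rfl | ha
    · simp [hτ]
    · rw [abs_mul, abs_of_nonneg (le_max_right (|a| - τ) 0)]
      rcases Real.sign_apply_eq_of_ne_zero a ha with h | h <;> simp [h]
  · rw [mul_sub, mul_left_comm, sign_mul_sign_self hx, mul_one]

theorem subdiffShrink_sq {τ : ℝ} (hτ : 0 ≤ τ) (x a : ℝ) :
    subdiffShrink x τ a ^ 2 = subdiffResidual x τ a ^ 2 := by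
  unfold subdiffShrink subdiffResidual
  split_ifs with hx
  · rcases eq_or_ne a 0 with rfl | ha
    · simp [hτ]
    · rw [mul_pow, sq (Real.sign a), sign_mul_sign_self ha, one_mul]
  · have := sign_mul_sign_self hx
    linear_combination (a ^ 2 - τ ^ 2) * (-this)

theorem mul_subdiffShrink (x τ a : ℝ) :
    a * subdiffShrink x τ a = subdiffResidual x τ a ^ 2 + τ * subdiffResidual x τ a := by
  unfold subdiffShrink subdiffResidual
  split_ifs with hx
  · rw [← mul_assoc, mul_comm a, sign_mul_self_eq_abs]
    rcases le_total (|a| - τ) 0 with h | h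
    · simp [h]
    · rw [max_eq_left h]; ring
  · have := sign_mul_sign_self hx
    linear_combination (-a ^ 2) * this

/-- The difference `a - subdiffShrink x τ a` lies in `τ ∂|·|(x)`, whose support function is `τ *
absDirDeriv x`. -/
theorem mul_le_residual {τ : ℝ} (hτ : 0 ≤ τ) (x a u : ℝ) :
    a * u ≤ subdiffShrink x τ a * u + τ * absDirDeriv x u := by
  unfold subdiffShrink absDirDeriv
  split_ifs with hx
  · have h : (a - Real.sign a * max (|a| - τ) 0) * u ≤ τ * |u| := by
      refine (le_abs_self _).trans ?_
      rw [abs_mul]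
      refine mul_le_mul_of_nonneg_right ?_ (abs_nonneg _)
      rcases le_total (|a| - τ) 0 with h | h
      · rw [max_eq_right h, mul_zero, sub_zero]
        linarith
      · rw [max_eq_left h]
        have := sign_mul_self_eq_abs a
        rcases lt_trichotomy a 0 with ha | rfl | ha
        · rw [Real.sign_of_neg ha, abs_of_neg ha]
          rw [show a - -1 * (-a - τ) = -τ by ring, abs_neg, abs_of_nonneg hτ]
        · simpa using hτ
        · rw [Real.sign_of_pos ha, abs_of_pos ha]
          rw [show a - 1 * (a - τ) = τ by ring, abs_of_nonneg hτ]
    linarith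
  · linarith

/-- Convexity in the parameter. On the support the square is an exact quadratic, and these
coordinates supply the strong convexity modulus `s` after summation. -/
theorem subdiffResidual_sq_ge (x τ τ' a : ℝ) :
    subdiffResidual x τ a ^ 2 - 2 * subdiffResidual x τ a * (τ' - τ)
      + (if x = 0 then 0 else (τ' - τ) ^ 2) ≤ subdiffResidual x τ' a ^ 2 := by
  unfold subdiffResidual
  split_ifs with hx
  · simpa using max_sub_sq_ge |a| τ τ'
  · apply le_of_eq; ring

end AbsoluteValue

/-! ### Support functions on the unit ball: continuity and integrability. -/

section SupportFunction

variable {n : ℕ}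

/-- The supremum of the functional `⟨g, ·⟩` over the part of `K` in the unit ball. -/
noncomputable def supportFun (K : Set (EuclideanSpace ℝ (Fin n))) (g : EuclideanSpace ℝ (Fin n)) :
    ℝ :=
  sSup ((fun t => inner ℝ g t) '' (K ∩ Metric.closedBall 0 1))

variable {K : Set (EuclideanSpace ℝ (Fin n))}

theorem inner_le_norm_of_mem_ball (g : EuclideanSpace ℝ (Fin n)) {t : EuclideanSpace ℝ (Fin n)}
    (ht : t ∈ Metric.closedBall (0 : EuclideanSpace ℝ (Fin n)) 1) : inner ℝ g t ≤ ‖g‖ := by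
  have ht : ‖t‖ ≤ 1 := by simpa using ht
  exact (real_inner_le_norm g t).trans (mul_le_of_le_one_right (norm_nonneg g) ht)

theorem le_supportFun (g : EuclideanSpace ℝ (Fin n)) {t : EuclideanSpace ℝ (Fin n)} (ht : t ∈ K)
    (ht' : ‖t‖ ≤ 1) : inner ℝ g t ≤ supportFun K g := by
  refine le_csSup ⟨‖g‖, ?_⟩ ⟨t, ⟨ht, by simpa using ht'⟩, rfl⟩
  rintro _ ⟨u, hu, rfl⟩
  exact inner_le_norm_of_mem_ball g hu.2

theorem supportFun_le (h0 : 0 ∈ K) {g : EuclideanSpace ℝ (Fin n)} {c : ℝ}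
    (h : ∀ t ∈ K, ‖t‖ ≤ 1 → inner ℝ g t ≤ c) : supportFun K g ≤ c := by
  refine csSup_le ⟨_, 0, ⟨h0, by simp⟩, rfl⟩ ?_
  rintro _ ⟨u, hu, rfl⟩
  exact h u hu.1 (by simpa using hu.2)

theorem supportFun_nonneg (h0 : 0 ∈ K) (g : EuclideanSpace ℝ (Fin n)) : 0 ≤ supportFun K g := by
  simpa using le_supportFun g h0 (by simp)

theorem supportFun_le_norm (h0 : 0 ∈ K) (g : EuclideanSpace ℝ (Fin n)) : supportFun K g ≤ ‖g‖ :=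
  supportFun_le h0 fun t _ ht' => inner_le_norm_of_mem_ball g (by simpa using ht')

theorem continuous_supportFun (h0 : 0 ∈ K) : Continuous (supportFun K) := by
  refine (LipschitzWith.of_le_add fun g g' => supportFun_le h0 fun t ht ht' => ?_).continuous
  have h1 := le_supportFun g' ht ht'
  have h2 := inner_le_norm_of_mem_ball (g - g') (t := t) (by simpa using ht')
  rw [inner_sub_left] at h2
  rw [dist_eq_norm]
  linarith

theorem integrable_norm_sq_stdGaussian :
    Integrable (fun g => ‖g‖ ^ 2) (stdGaussian (EuclideanSpace ℝ (Fin n))) :=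
  (IsGaussian.memLp_two_id (μ := stdGaussian (EuclideanSpace ℝ (Fin n)))).integrable_norm_pow
    two_ne_zero

theorem integrable_supportFun_sq (h0 : 0 ∈ K) :
    Integrable (fun g => supportFun K g ^ 2) (stdGaussian (EuclideanSpace ℝ (Fin n))) := by
  refine integrable_norm_sq_stdGaussian.mono'
    ((continuous_supportFun h0).pow 2).aestronglyMeasurable (.of_forall fun g => ?_)
  rw [norm_pow, Real.norm_of_nonneg (supportFun_nonneg h0 g)]
  exact pow_le_pow_left₀ (supportFun_nonneg h0 g) (supportFun_le_norm h0 g) 2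

theorem statisticalDimension_eq :
    statisticalDimension K
      = ∫ g, supportFun K g ^ 2 ∂stdGaussian (EuclideanSpace ℝ (Fin n)) := rfl

end SupportFunction

/-! ### Pointwise bounds for the support function of the cone. -/

section Cone

variable {n : ℕ} {x : EuclideanSpace ℝ (Fin n)}

theorem mem_l1Cone_iff (u : EuclideanSpace ℝ (Fin n)) :
    u ∈ priorRestrictedCone (l1BoundedNormProgram n) x ↔
      ∃ t : ℝ, 0 < t ∧ ∑ i, |x i + t * u i| ≤ ∑ i, |x i| ∧ ‖x + t • u‖ ≤ ‖x‖ := by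
  simp [priorRestrictedCone, priorRestrictedSet, l1BoundedNormProgram, Fin.forall_fin_two,
    EReal.coe_le_coe_iff]

theorem zero_mem_l1Cone : 0 ∈ priorRestrictedCone (l1BoundedNormProgram n) x :=
  (mem_l1Cone_iff 0).2 ⟨1, one_pos, by simp, by simp⟩

theorem smul_mem_l1Cone {u : EuclideanSpace ℝ (Fin n)}
    (hu : u ∈ priorRestrictedCone (l1BoundedNormProgram n) x) {c : ℝ} (hc : 0 < c) :
    c • u ∈ priorRestrictedCone (l1BoundedNormProgram n) x := by
  obtain ⟨t, ht, h⟩ := hu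
  exact ⟨t / c, div_pos ht hc, by rwa [smul_smul, div_mul_cancel₀ _ hc.ne']⟩

theorem sum_absDirDeriv_nonpos {u : EuclideanSpace ℝ (Fin n)}
    (hu : u ∈ priorRestrictedCone (l1BoundedNormProgram n) x) :
    ∑ i, absDirDeriv (x i) (u i) ≤ 0 := by
  obtain ⟨t, ht, h, -⟩ := (mem_l1Cone_iff u).1 hu
  have h1 : ∑ i, (|x i| + absDirDeriv (x i) (t * u i)) ≤ ∑ i, |x i + t * u i| :=
    Finset.sum_le_sum fun i _ => abs_add_absDirDeriv_le _ _
  simp_rw [absDirDeriv_mul _ _ ht.le] at h1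
  rw [Finset.sum_add_distrib, ← Finset.mul_sum] at h1
  exact nonpos_of_mul_nonpos_right (by linarith) ht

/-- For small `t` no support coordinate changes sign, so the ℓ₁ norm is exactly its first-order
expansion. The Euclidean ball is curved, so its constraint needs strict negativity to absorb `t²
‖u‖²`. -/
theorem mem_l1Cone_of_inner_neg {u : EuclideanSpace ℝ (Fin n)}
    (hu : ∑ i, absDirDeriv (x i) (u i) ≤ 0) (hxu : inner ℝ x u < 0) :
    u ∈ priorRestrictedCone (l1BoundedNormProgram n) x := by
  have h1 : ∀ᶠ t : ℝ in 𝓝[>] 0, ∀ i, x i ≠ 0 → |t * u i| < |x i| := by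
    refine eventually_all.2 fun i => ?_
    rcases eq_or_ne (x i) 0 with h | h
    · simp [h]
    · have hc : ContinuousAt (fun t : ℝ => |t * u i|) 0 := by fun_prop
      have := hc.eventually_lt (continuousAt_const (y := |x i|)) (by simpa using h)
      filter_upwards [this.filter_mono nhdsWithin_le_nhds] with t ht _ using ht
  have h2 : ∀ᶠ t : ℝ in 𝓝[>] 0, 2 * inner ℝ x u + t * ‖u‖ ^ 2 < 0 := by
    have hc : ContinuousAt (fun t : ℝ => 2 * inner ℝ x u + t * ‖u‖ ^ 2) 0 := by fun_prop
    have := hc.eventually_lt (continuousAt_const (y := 0)) (by simp only [zero_mul]; linarith)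
    exact this.filter_mono nhdsWithin_le_nhds
  obtain ⟨t, ⟨h1, h2⟩, ht⟩ := ((h1.and h2).and self_mem_nhdsWithin).exists
  have ht : 0 < t := ht
  refine (mem_l1Cone_iff u).2 ⟨t, ht, ?_, ?_⟩
  · simp_rw [fun i => abs_add_eq_of_abs_lt (h1 i), absDirDeriv_mul _ _ ht.le]
    rw [Finset.sum_add_distrib, ← Finset.mul_sum]
    nlinarith
  · refine le_of_sq_le_sq ?_ (norm_nonneg _)
    rw [norm_add_sq_real, inner_smul_right, norm_smul, Real.norm_of_nonneg ht.le]
    nlinarith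

theorem inner_eq_sum (u v : EuclideanSpace ℝ (Fin n)) : inner ℝ u v = ∑ i, u i * v i := by
  simp [PiLp.inner_apply, mul_comm]

theorem supportFun_sq_le {τ : ℝ} (hτ : 0 ≤ τ) (g : EuclideanSpace ℝ (Fin n)) :
    supportFun (priorRestrictedCone (l1BoundedNormProgram n) x) g ^ 2
      ≤ ∑ i, subdiffResidual (x i) τ (g i) ^ 2 := by
  set w : EuclideanSpace ℝ (Fin n) := WithLp.toLp 2 fun i => subdiffShrink (x i) τ (g i) with hw
  have hw2 : ‖w‖ ^ 2 = ∑ i, subdiffResidual (x i) τ (g i) ^ 2 := by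
    rw [EuclideanSpace.real_norm_sq_eq]
    exact Finset.sum_congr rfl fun i _ => subdiffShrink_sq hτ _ _
  rw [← hw2]
  refine pow_le_pow_left₀ (supportFun_nonneg zero_mem_l1Cone g)
    (supportFun_le zero_mem_l1Cone fun t ht ht' => ?_) 2
  have h1 : inner ℝ g t ≤ inner ℝ w t + τ * ∑ i, absDirDeriv (x i) (t i) := by
    rw [inner_eq_sum, inner_eq_sum, Finset.mul_sum, ← Finset.sum_add_distrib]
    exact Finset.sum_le_sum fun i _ => mul_le_residual hτ _ _ _
  have h2 := mul_nonpos_of_nonneg_of_nonpos hτ (sum_absDirDeriv_nonpos ht)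
  have h3 := inner_le_norm_of_mem_ball w (t := t) (by simpa using ht')
  linarith

/-- Directions in the closure of the cone bound the support function from below. -/
theorem inner_le_norm_mul_supportFun (hx : x ≠ 0) {u : EuclideanSpace ℝ (Fin n)}
    (hu : ∑ i, absDirDeriv (x i) (u i) ≤ 0) (hxu : inner ℝ x u ≤ 0)
    (g : EuclideanSpace ℝ (Fin n)) :
    inner ℝ g u ≤ ‖u‖ * supportFun (priorRestrictedCone (l1BoundedNormProgram n) x) g := by
  set C := priorRestrictedCone (l1BoundedNormProgram n) x
  have hpos : 0 < ‖x‖ ^ 2 := by positivity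
  -- Subtracting `η • x` lowers the ℓ₁ derivative by `η ‖x‖₁` and makes the inner product with `x`
  -- strictly negative; then `η → 0`.
  have key : ∀ η : ℝ, 0 < η → inner ℝ g (u - η • x) ≤ ‖u - η • x‖ * supportFun C g := by
    intro η hη
    have hmem : u - η • x ∈ C := by
      refine mem_l1Cone_of_inner_neg ?_ ?_
      · simp only [PiLp.sub_apply, PiLp.smul_apply, smul_eq_mul]
        simp_rw [absDirDeriv_sub_mul (x := x _) (y := x _) id, sign_mul_self_eq_abs]
        rw [Finset.sum_sub_distrib, ← Finset.mul_sum]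
        have : 0 ≤ η * ∑ i, |x i| := by positivity
        linarith
      · rw [inner_sub_right, inner_smul_right, real_inner_self_eq_norm_sq]
        nlinarith
    rcases eq_or_ne (u - η • x) 0 with h | h
    · simp [h]
    · have hn : 0 < ‖u - η • x‖ := norm_pos_iff.2 h
      have := le_supportFun g (smul_mem_l1Cone hmem (inv_pos.2 hn))
        (by rw [norm_smul, norm_inv, norm_norm, inv_mul_cancel₀ hn.ne'])
      rw [inner_smul_right] at this
      rwa [← inv_mul_le_iff₀ hn]
  have t1 : Tendsto (fun η : ℝ => inner ℝ g (u - η • x)) (𝓝[>] 0) (𝓝 (inner ℝ g u)) := by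
    have : Continuous fun η : ℝ => inner ℝ g (u - η • x) := by fun_prop
    simpa using (this.tendsto 0).mono_left nhdsWithin_le_nhds
  have t2 : Tendsto (fun η : ℝ => ‖u - η • x‖ * supportFun C g) (𝓝[>] 0)
      (𝓝 (‖u‖ * supportFun C g)) := by
    have : Continuous fun η : ℝ => ‖u - η • x‖ * supportFun C g := by fun_prop
    simpa using (this.tendsto 0).mono_left nhdsWithin_le_nhds
  exact le_of_tendsto_of_tendsto t1 t2
    (by filter_upwards [self_mem_nhdsWithin] with η hη using key η hη)

/-- The component of `x` orthogonal to its sign vector. -/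
noncomputable def signOrthogonal (x : EuclideanSpace ℝ (Fin n)) (s : ℕ) :
    EuclideanSpace ℝ (Fin n) :=
  WithLp.toLp 2 fun i => x i - (∑ j, |x j|) / s * Real.sign (x i)

theorem sum_ite_eq_zero {s : ℕ} (hx : (Finset.univ.filter (fun i : Fin n => x i ≠ 0)).card = s)
    (a b : ℝ) : ∑ i, (if x i = 0 then a else b) = (n - s : ℝ) * a + s * b := by
  have h := Finset.card_filter_add_card_filter_not (s := Finset.univ) (fun i : Fin n => x i ≠ 0)
  rw [hx, Finset.card_univ, Fintype.card_fin] at h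
  simp only [not_not] at h
  rw [Finset.sum_ite, Finset.sum_const, Finset.sum_const, hx, nsmul_eq_mul, nsmul_eq_mul,
    show (n : ℝ) - s = ((Finset.univ.filter fun i : Fin n => x i = 0).card : ℝ) by
      rw [sub_eq_iff_eq_add', ← Nat.cast_add, h]]

theorem sum_sign_mul_signOrthogonal {s : ℕ} (hs : 1 ≤ s)
    (hx : (Finset.univ.filter (fun i : Fin n => x i ≠ 0)).card = s) :
    ∑ i, Real.sign (x i) * signOrthogonal x s i = 0 := by
  have h : ∀ i, Real.sign (x i) * signOrthogonal x s i
      = |x i| - (∑ j, |x j|) / s * (if x i = 0 then 0 else 1) := by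
    intro i
    rw [signOrthogonal]
    simp only
    split_ifs with h
    · simp [h]
    · linear_combination sign_mul_self_eq_abs (x i)
        - (∑ j, |x j|) / s * sign_mul_sign_self h
  have hs' : (s : ℝ) ≠ 0 := by positivity
  simp_rw [h]
  rw [Finset.sum_sub_distrib, ← Finset.mul_sum, sum_ite_eq_zero hx]
  field_simp
  ring

theorem supportFun_sq_ge {s : ℕ} (hs : 1 ≤ s)
    (hx : (Finset.univ.filter (fun i : Fin n => x i ≠ 0)).card = s) (τ : ℝ)
    (g : EuclideanSpace ℝ (Fin n)) :
    ∑ i, subdiffResidual (x i) τ (g i) ^ 2 - (∑ i, subdiffResidual (x i) τ (g i)) ^ 2 / s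
        - max (inner ℝ (signOrthogonal x s) g) 0 ^ 2 / ‖signOrthogonal x s‖ ^ 2
      ≤ supportFun (priorRestrictedCone (l1BoundedNormProgram n) x) g ^ 2 := by
  have hs' : (0 : ℝ) < s := by positivity
  set C := priorRestrictedCone (l1BoundedNormProgram n) x with hC
  set p := signOrthogonal x s with hp
  have hpo := sum_sign_mul_signOrthogonal hs hx
  have hp0 : ∀ i, x i = 0 → p i = 0 := fun i h => by simp [hp, signOrthogonal, h]
  have hx0 : x ≠ 0 := by
    rintro rfl
    simp at hx
    omega
  -- choose the optimal parameter for this `g`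
  obtain ⟨σ, hσ, hσn, hσc⟩ : ∃ σ, 0 ≤ σ ∧ ∑ i, subdiffResidual (x i) σ (g i) ≤ 0 ∧
      σ * ∑ i, subdiffResidual (x i) σ (g i) = 0 := by
    have hc : Continuous fun σ => ∑ i, subdiffResidual (x i) σ (g i) := by
      refine continuous_finsetSum _ fun i _ => ?_
      unfold subdiffResidual
      split_ifs <;> fun_prop
    -- At this parameter the `s` support coordinates together subtract all of `∑ |g i|`, an upper
    -- bound for the rest.
    have hT : 0 ≤ (∑ i, |g i|) / s := by positivity
    refine exists_complementary_point hc hT ?_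
    have h1 : ∀ i, subdiffResidual (x i) ((∑ i, |g i|) / s) (g i)
        ≤ |g i| - (if x i = 0 then 0 else (∑ i, |g i|) / s) := by
      intro i
      unfold subdiffResidual
      split_ifs
      · rw [sub_zero]
        exact max_le (by linarith) (abs_nonneg _)
      · linarith [sign_mul_le_abs (x i) (g i)]
    refine (Finset.sum_le_sum fun i _ => h1 i).trans ?_
    rw [Finset.sum_sub_distrib, sum_ite_eq_zero hx]
    apply le_of_eq; field_simp; ring
  set w : EuclideanSpace ℝ (Fin n) := WithLp.toLp 2 fun i => subdiffShrink (x i) σ (g i) with hw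
  have hw2 : ‖w‖ ^ 2 = ∑ i, subdiffResidual (x i) σ (g i) ^ 2 := by
    rw [EuclideanSpace.real_norm_sq_eq]
    exact Finset.sum_congr rfl fun i _ => subdiffShrink_sq hσ _ _
  have hgw : inner ℝ g w = ‖w‖ ^ 2 := by
    rw [hw2, inner_eq_sum]
    calc ∑ i, g i * w i
        = ∑ i, (subdiffResidual (x i) σ (g i) ^ 2 + σ * subdiffResidual (x i) σ (g i)) :=
          Finset.sum_congr rfl fun i _ => mul_subdiffShrink _ _ _
      _ = _ := by rw [Finset.sum_add_distrib, ← Finset.mul_sum, hσc, add_zero]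
  have hwK : ∑ i, absDirDeriv (x i) (w i) ≤ 0 := by
    exact (Finset.sum_congr rfl fun i _ => absDirDeriv_subdiffShrink hσ _ _).trans_le hσn
  have hpw : inner ℝ p w = inner ℝ p g := by
    rw [inner_eq_sum, inner_eq_sum]
    -- On the support `w` differs from `g` by a multiple of the sign vector, which is orthogonal to
    -- `p`; elsewhere `p` vanishes.
    have h1 : ∀ i, p i * w i = p i * g i - σ * (Real.sign (x i) * p i) := by
      intro i
      rcases eq_or_ne (x i) 0 with h | h
      · simp [hp0 i h]
      · simp only [hw, subdiffShrink, h, if_false]; ring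
    simp_rw [h1]
    rw [Finset.sum_sub_distrib, ← Finset.mul_sum, hpo, mul_zero, sub_zero]
  -- project away the part of `w` that leaves the half space
  set c := max (inner ℝ p g) 0 / ‖p‖ ^ 2 with hcdef
  -- If `p = 0`, division by zero makes `c = 0` and both sides vanish.
  have hcp : c * ‖p‖ ^ 2 = max (inner ℝ p g) 0 := by
    rcases eq_or_ne p 0 with h | h
    · simp [h]
    · have : ‖p‖ ≠ 0 := norm_ne_zero_iff.2 h
      rw [hcdef]; field_simp
  have hvK : ∑ i, absDirDeriv (x i) ((w - c • p) i) ≤ 0 := by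
    simp only [PiLp.sub_apply, PiLp.smul_apply, smul_eq_mul]
    simp_rw [fun i => absDirDeriv_sub_mul (hp0 i) (w i) c]
    rw [Finset.sum_sub_distrib, ← Finset.mul_sum, hpo]
    simpa using hwK
  have hpv : inner ℝ p (w - c • p) ≤ 0 := by
    rw [inner_sub_right, inner_smul_right, real_inner_self_eq_norm_sq, hpw, hcp]
    linarith [le_max_left (inner ℝ p g) 0]
  have hxv : inner ℝ x (w - c • p) ≤ 0 := by
    set v := w - c • p
    -- `x` is `p` plus a nonnegative multiple of its sign vector, and pairing with the latter is
    -- bounded by the ℓ₁ derivative.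
    have h1 : inner ℝ x v
        = inner ℝ p v + (∑ j, |x j|) / s * ∑ i, Real.sign (x i) * v i := by
      rw [inner_eq_sum, inner_eq_sum, Finset.mul_sum, ← Finset.sum_add_distrib]
      refine Finset.sum_congr rfl fun i _ => ?_
      simp only [hp, signOrthogonal]; ring
    have h2 : ∑ i, Real.sign (x i) * v i ≤ 0 :=
      (Finset.sum_le_sum fun i _ => sign_mul_le_absDirDeriv _ _).trans hvK
    have h3 : 0 ≤ (∑ j, |x j|) / s := by positivity
    nlinarith
  have hmm : inner ℝ p g * max (inner ℝ p g) 0 = max (inner ℝ p g) 0 ^ 2 := by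
    rcases le_total (inner ℝ p g) 0 with h | h <;> simp [h, sq]
  have hcc : c * max (inner ℝ p g) 0 = max (inner ℝ p g) 0 ^ 2 / ‖p‖ ^ 2 := by
    rw [hcdef]; ring
  have hcm : c * inner ℝ p g = max (inner ℝ p g) 0 ^ 2 / ‖p‖ ^ 2 := by
    rw [hcdef, div_mul_eq_mul_div, mul_comm, hmm]
  have hv2 : ‖w - c • p‖ ^ 2 = ‖w‖ ^ 2 - max (inner ℝ p g) 0 ^ 2 / ‖p‖ ^ 2 := by
    rw [norm_sub_sq_real, inner_smul_right, real_inner_comm, hpw, hcm, norm_smul, mul_pow,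
      Real.norm_eq_abs, sq_abs]
    linear_combination c * hcp + hcc
  have hgv : inner ℝ g (w - c • p) = ‖w - c • p‖ ^ 2 := by
    rw [hv2, inner_sub_right, inner_smul_right, real_inner_comm p g, hcm, hgw]
  have hfin : ‖w - c • p‖ ^ 2 ≤ supportFun C g ^ 2 := by
    have h := inner_le_norm_mul_supportFun hx0 hvK hxv g
    rw [hgv] at h
    rcases (norm_nonneg (w - c • p)).eq_or_lt with h0 | h0
    · rw [← h0, zero_pow two_ne_zero]; exact sq_nonneg _
    · refine pow_le_pow_left₀ h0.le ?_ 2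
      rw [sq] at h
      exact le_of_mul_le_mul_left h h0
  have hconv : ∑ i, subdiffResidual (x i) τ (g i) ^ 2
      - (∑ i, subdiffResidual (x i) τ (g i)) ^ 2 / s ≤ ‖w‖ ^ 2 := by
    rw [hw2]
    have h1 := Finset.sum_le_sum fun i (_ : i ∈ Finset.univ) =>
      subdiffResidual_sq_ge (x i) τ σ (g i)
    rw [Finset.sum_add_distrib, sum_ite_eq_zero hx, Finset.sum_sub_distrib, ← Finset.sum_mul,
      ← Finset.mul_sum] at h1
    refine le_trans ?_ h1
    set X := ∑ i, subdiffResidual (x i) τ (g i)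
    -- Completing the square bounds the quadratic in `σ - τ` below by `-X ^ 2 / s`, whatever `σ` is.
    have h2 : (0 : ℝ) ≤ (s * (σ - τ) - X) ^ 2 / s := div_nonneg (sq_nonneg _) hs'.le
    have h3 : (s * (σ - τ) - X) ^ 2 / s = s * (σ - τ) ^ 2 - 2 * X * (σ - τ) + X ^ 2 / s := by
      field_simp; ring
    linarith
  linarith

end Cone

/-! ### Gaussian expectations of coordinate sums and of a positive part. -/

section Expectation

variable {n : ℕ}

theorem measurePreserving_coord_stdGaussian (i : Fin n) :
    MeasurePreserving (fun g : EuclideanSpace ℝ (Fin n) => g i)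
      (stdGaussian (EuclideanSpace ℝ (Fin n))) (gaussianReal 0 1) := by
  refine ⟨by fun_prop, ?_⟩
  rw [← map_pi_eq_stdGaussian, Measure.map_map (by fun_prop) (by fun_prop)]
  exact (measurePreserving_eval (fun _ : Fin n => gaussianReal 0 1) i).map_eq

theorem integrable_sum_coord_stdGaussian {f : Fin n → ℝ → ℝ}
    (hf : ∀ i, Integrable (f i) (gaussianReal 0 1)) :
    Integrable (fun g => ∑ i, f i (g i)) (stdGaussian (EuclideanSpace ℝ (Fin n))) :=
  integrable_finsetSum _ fun i _ =>
    (measurePreserving_coord_stdGaussian i).integrable_comp_of_integrable (hf i)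

theorem integral_sum_coord_stdGaussian {f : Fin n → ℝ → ℝ}
    (hf : ∀ i, Integrable (f i) (gaussianReal 0 1)) :
    ∫ g, ∑ i, f i (g i) ∂stdGaussian (EuclideanSpace ℝ (Fin n))
      = ∑ i, ∫ u, f i u ∂gaussianReal 0 1 := by
  have hi : ∀ i, Integrable (fun g : EuclideanSpace ℝ (Fin n) => f i (g i))
      (stdGaussian (EuclideanSpace ℝ (Fin n))) := fun i =>
    (measurePreserving_coord_stdGaussian i).integrable_comp_of_integrable (hf i)
  rw [integral_finsetSum _ fun i _ => hi i]
  refine Finset.sum_congr rfl fun i _ => ?_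
  have h := measurePreserving_coord_stdGaussian i
  rw [← h.map_eq, integral_map h.aemeasurable]
  rw [h.map_eq]
  exact (hf i).aestronglyMeasurable

theorem memLp_sum_coord_stdGaussian {f : Fin n → ℝ → ℝ}
    (hf : ∀ i, MemLp (f i) 2 (gaussianReal 0 1)) :
    MemLp (fun g => ∑ i, f i (g i)) 2 (stdGaussian (EuclideanSpace ℝ (Fin n))) :=
  memLp_finsetSum _ fun i _ =>
    (hf i).comp_measurePreserving (measurePreserving_coord_stdGaussian i)

theorem variance_sum_coord_stdGaussian {f : Fin n → ℝ → ℝ}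
    (hf : ∀ i, MemLp (f i) 2 (gaussianReal 0 1)) :
    Var[fun g => ∑ i, f i (g i); stdGaussian (EuclideanSpace ℝ (Fin n))]
      = ∑ i, Var[f i; gaussianReal 0 1] := by
  have hm := (memLp_sum_coord_stdGaussian hf).aestronglyMeasurable.aemeasurable
  rw [← map_pi_eq_stdGaussian] at hm ⊢
  rw [variance_map hm (by fun_prop), ← variance_sum_pi hf]
  congr 1
  ext g
  simp

theorem memLp_subdiffResidual (x τ : ℝ) : MemLp (subdiffResidual x τ) 2 (gaussianReal 0 1) := by
  unfold subdiffResidual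
  split_ifs
  · exact memLp_excess τ
  · exact ((memLp_id_gaussianReal 2).const_mul _).sub (memLp_const τ)

theorem integral_subdiffResidual (x τ : ℝ) :
    ∫ u, subdiffResidual x τ u ∂gaussianReal 0 1
      = if x = 0 then excessMoment 1 τ else -τ := by
  unfold subdiffResidual
  split_ifs
  · rw [excessMoment_one]
  · have hi : Integrable (fun u : ℝ => u) (gaussianReal 0 1) :=
      (memLp_id_gaussianReal 1).integrable (by norm_num)
    rw [integral_sub (hi.const_mul _) (integrable_const τ), integral_const_mul]
    simp [integral_id_gaussianReal]

theorem integral_subdiffResidual_sq (x τ : ℝ) :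
    ∫ u, subdiffResidual x τ u ^ 2 ∂gaussianReal 0 1
      = if x = 0 then excessMoment 2 τ else 1 + τ ^ 2 := by
  unfold subdiffResidual
  split_ifs with hx
  · rw [excessMoment]
  · have h : ∀ u : ℝ, (Real.sign x * u - τ) ^ 2
        = u ^ 2 - 2 * τ * Real.sign x * u + τ ^ 2 := fun u => by
      linear_combination u ^ 2 * sign_mul_sign_self hx
    have hi : Integrable (fun u : ℝ => u) (gaussianReal 0 1) :=
      (memLp_id_gaussianReal 1).integrable (by norm_num)
    have hi2 : Integrable (fun u : ℝ => u ^ 2) (gaussianReal 0 1) :=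
      (memLp_id_gaussianReal 2).integrable_sq
    have hi3 : Integrable (fun u : ℝ => u ^ 2 - 2 * τ * Real.sign x * u) (gaussianReal 0 1) :=
      hi2.sub (hi.const_mul _)
    simp_rw [h]
    rw [integral_add hi3 (integrable_const _),
      integral_sub hi2 (hi.const_mul _), integral_const_mul, integral_sq_gaussianReal]
    simp [integral_id_gaussianReal]

theorem variance_subdiffResidual_le (x τ : ℝ) :
    Var[subdiffResidual x τ; gaussianReal 0 1] ≤ if x = 0 then excessMoment 2 τ else 1 := by
  rw [variance_eq_sub (memLp_subdiffResidual x τ), integral_subdiffResidual]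
  simp only [Pi.pow_apply]
  rw [integral_subdiffResidual_sq]
  split_ifs
  · linarith [sq_nonneg (excessMoment 1 τ)]
  · apply le_of_eq; ring

/-- By the symmetry `g ↦ -g`, positive and negative parts each carry half of the second moment `‖p‖
^ 2`. -/
theorem integral_max_inner_sq (p : EuclideanSpace ℝ (Fin n)) :
    ∫ g, max (inner ℝ p g) 0 ^ 2 ∂stdGaussian (EuclideanSpace ℝ (Fin n)) = ‖p‖ ^ 2 / 2 := by
  set μ := stdGaussian (EuclideanSpace ℝ (Fin n))
  have hL : MemLp (fun g => inner ℝ p g) 2 μ :=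
    (IsGaussian.memLp_two_id (μ := μ)).const_inner p
  have hI : Integrable (fun g => max (inner ℝ p g) 0 ^ 2) μ := hL.pos_part.integrable_sq
  have hI' : Integrable (fun g => max (-inner ℝ p g) 0 ^ 2) μ := hL.neg.pos_part.integrable_sq
  have hneg : ∫ g, max (-inner ℝ p g) 0 ^ 2 ∂μ = ∫ g, max (inner ℝ p g) 0 ^ 2 ∂μ := by
    have hmap : μ.map (LinearIsometryEquiv.neg ℝ) = μ := stdGaussian_map _
    conv_rhs => rw [← hmap]
    rw [integral_map (by fun_prop) (by fun_prop)]
    simp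
  have hvar : ∫ g, inner ℝ p g ^ 2 ∂μ = ‖p‖ ^ 2 := by
    have h1 := variance_dual_stdGaussian (innerSL ℝ p)
    have h2 := integral_strongDual_stdGaussian (innerSL ℝ p)
    rw [variance_of_integral_eq_zero (by fun_prop) h2, innerSL_apply_norm] at h1
    simpa using h1
  have hadd : ∫ g, inner ℝ p g ^ 2 ∂μ
      = ∫ g, max (inner ℝ p g) 0 ^ 2 ∂μ + ∫ g, max (-inner ℝ p g) 0 ^ 2 ∂μ := by
    rw [← integral_add hI hI']
    refine integral_congr_ae (.of_forall fun g => ?_)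
    rcases le_total (inner ℝ p g) 0 with h | h <;> simp [h]
  linarith

end Expectation

/-! ### Bounds for the statistical dimension. -/

section StatisticalDimension

variable {n s : ℕ} {x : EuclideanSpace ℝ (Fin n)}

theorem integral_sum_subdiffResidual_sq
    (hx : (Finset.univ.filter (fun i : Fin n => x i ≠ 0)).card = s) (τ : ℝ) :
    ∫ g, ∑ i, subdiffResidual (x i) τ (g i) ^ 2 ∂stdGaussian (EuclideanSpace ℝ (Fin n))
      = (n - s : ℝ) * excessMoment 2 τ + s * (1 + τ ^ 2) := by
  rw [integral_sum_coord_stdGaussian (f := fun i u => subdiffResidual (x i) τ u ^ 2)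
    fun i => (memLp_subdiffResidual (x i) τ).integrable_sq]
  simp_rw [integral_subdiffResidual_sq]
  exact sum_ite_eq_zero hx _ _

/-- The stationary equation says that the sum has mean zero, so its second moment is a sum of
coordinate variances by independence. -/
theorem integral_sq_sum_subdiffResidual_le
    (hx : (Finset.univ.filter (fun i : Fin n => x i ≠ 0)).card = s) {τ : ℝ}
    (hτ : s * τ = (n - s : ℝ) * excessMoment 1 τ) :
    ∫ g, (∑ i, subdiffResidual (x i) τ (g i)) ^ 2 ∂stdGaussian (EuclideanSpace ℝ (Fin n))
      ≤ (n - s : ℝ) * excessMoment 2 τ + s := by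
  have hm := fun i => memLp_subdiffResidual (x i) τ
  have hL := memLp_sum_coord_stdGaussian hm
  have h0 : ∫ g, ∑ i, subdiffResidual (x i) τ (g i) ∂stdGaussian (EuclideanSpace ℝ (Fin n))
      = 0 := by
    rw [integral_sum_coord_stdGaussian fun i => (hm i).integrable (by norm_num)]
    simp_rw [integral_subdiffResidual]
    rw [sum_ite_eq_zero hx]
    linarith
  have hv := variance_sum_coord_stdGaussian hm
  rw [variance_of_integral_eq_zero hL.aestronglyMeasurable.aemeasurable h0] at hv
  rw [hv]
  refine (Finset.sum_le_sum fun i _ => variance_subdiffResidual_le (x i) τ).trans_eq ?_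
  rw [sum_ite_eq_zero hx, mul_one]

theorem natCast_le_of_card (hx : (Finset.univ.filter (fun i : Fin n => x i ≠ 0)).card = s) :
    (s : ℝ) ≤ n := by
  rw [← hx, Nat.cast_le]
  simpa using Finset.card_filter_le Finset.univ (fun i : Fin n => x i ≠ 0)

theorem mul_psi1Objective (hn : (n : ℝ) ≠ 0) {τ : ℝ} (hτ : 0 ≤ τ) :
    n * psi1Objective (s / n) τ = (n - s : ℝ) * excessMoment 2 τ + s * (1 + τ ^ 2) := by
  rw [psi1Objective_eq _ hτ]
  field_simp
  ring

theorem statisticalDimension_l1Cone_le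
    (hx : (Finset.univ.filter (fun i : Fin n => x i ≠ 0)).card = s) (hn : (n : ℝ) ≠ 0)
    {τ : ℝ} (hτ : 0 ≤ τ) :
    statisticalDimension (priorRestrictedCone (l1BoundedNormProgram n) x)
      ≤ n * psi1Objective (s / n) τ := by
  rw [mul_psi1Objective hn hτ, ← integral_sum_subdiffResidual_sq hx, statisticalDimension_eq]
  exact integral_mono (integrable_supportFun_sq zero_mem_l1Cone)
    (integrable_sum_coord_stdGaussian (f := fun i u => subdiffResidual (x i) τ u ^ 2)
      fun i => (memLp_subdiffResidual (x i) τ).integrable_sq)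
    fun g => supportFun_sq_le hτ g

theorem le_statisticalDimension_l1Cone (hs : 1 ≤ s)
    (hx : (Finset.univ.filter (fun i : Fin n => x i ≠ 0)).card = s) (hn : (n : ℝ) ≠ 0)
    {τ : ℝ} (hτ : 0 ≤ τ) (h : s * τ = (n - s : ℝ) * excessMoment 1 τ) :
    n * psi1Objective (s / n) τ - ((n - s : ℝ) * excessMoment 2 τ + s) / s - 1 / 2
      ≤ statisticalDimension (priorRestrictedCone (l1BoundedNormProgram n) x) := by
  set μ := stdGaussian (EuclideanSpace ℝ (Fin n)) with hμ
  set p := signOrthogonal x s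
  have hm := fun i => memLp_subdiffResidual (x i) τ
  have i1 : Integrable (fun g : EuclideanSpace ℝ (Fin n) =>
      ∑ i, subdiffResidual (x i) τ (g i) ^ 2) μ :=
    integrable_sum_coord_stdGaussian (f := fun i u => subdiffResidual (x i) τ u ^ 2)
      fun i => (hm i).integrable_sq
  have i2 : Integrable (fun g : EuclideanSpace ℝ (Fin n) =>
      (∑ i, subdiffResidual (x i) τ (g i)) ^ 2 / s) μ :=
    (memLp_sum_coord_stdGaussian hm).integrable_sq.div_const _
  have i3 : Integrable (fun g => max (inner ℝ p g) 0 ^ 2 / ‖p‖ ^ 2) μ :=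
    ((IsGaussian.memLp_two_id (μ := μ)).const_inner p).pos_part.integrable_sq.div_const _
  have i4 : Integrable (fun g : EuclideanSpace ℝ (Fin n) =>
      ∑ i, subdiffResidual (x i) τ (g i) ^ 2
        - (∑ i, subdiffResidual (x i) τ (g i)) ^ 2 / s) μ := i1.sub i2
  have hmono := integral_mono (i4.sub i3)
    (integrable_supportFun_sq zero_mem_l1Cone) fun g => supportFun_sq_ge hs hx τ g
  rw [← statisticalDimension_eq] at hmono
  simp only [Pi.sub_apply] at hmono
  rw [integral_sub i4 i3, integral_sub i1 i2, integral_div, integral_div,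
    integral_sum_subdiffResidual_sq hx, integral_max_inner_sq, ← mul_psi1Objective hn hτ] at hmono
  have h2 := div_le_div_of_nonneg_right (integral_sq_sum_subdiffResidual_le hx h)
    (Nat.cast_nonneg (α := ℝ) s)
  -- An inequality only, since the left side is `0` when `p = 0`.
  have h3 : ‖p‖ ^ 2 / 2 / ‖p‖ ^ 2 ≤ 1 / 2 := by
    rw [div_right_comm]
    exact div_le_div_of_nonneg_right (div_self_le_one _) zero_le_two
  linarith

/-- With `r = √(n/s)` the quotient is at most `r ^ 2`, because the second moment is at most `1`. It
is also at most `3`, by `mul_excessMoment_two_le` and stationarity. The first bound suffices for `r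
≤ 2`, the second for `r ≥ 2`. -/
theorem variance_bound (hs : 1 ≤ s) (hsn : (s : ℝ) ≤ n) {τ : ℝ} (hτ : 0 ≤ τ)
    (hpos : (s : ℝ) < n → 0 < τ) (h : s * τ = (n - s : ℝ) * excessMoment 1 τ) :
    ((n - s : ℝ) * excessMoment 2 τ + s) / s ≤ 2 * √((n : ℝ) / s) := by
  have hs' : (0 : ℝ) < s := by positivity
  set r := √((n : ℝ) / s) with hr
  have hr0 : 0 ≤ r := Real.sqrt_nonneg _
  have hr2 : r ^ 2 = n / s := Real.sq_sqrt (by positivity)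
  have h1 : ((n - s : ℝ) * excessMoment 2 τ + s) / s ≤ r ^ 2 := by
    rw [hr2]
    refine div_le_div_of_nonneg_right ?_ hs'.le
    nlinarith [excessMoment_two_le_one hτ, sub_nonneg.2 hsn]
  have h3 : ((n - s : ℝ) * excessMoment 2 τ + s) / s ≤ 3 := by
    rw [div_le_iff₀ hs']
    rcases hsn.eq_or_lt with he | hlt
    · rw [← he]; linarith
    · have hτ' := hpos hlt
      have h4 := mul_le_mul_of_nonneg_left (mul_excessMoment_two_le hτ) (sub_nonneg.2 hsn)
      have h5 : τ * ((n - s : ℝ) * excessMoment 2 τ) ≤ τ * (2 * s) := by linarith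
      linarith [le_of_mul_le_mul_left h5 hτ']
  rcases le_total r 2 with h2 | h2
  · nlinarith
  · linarith

end StatisticalDimension

theorem mainTheorem9 (n s : ℕ) (x : EuclideanSpace ℝ (Fin n))
    (hx : (Finset.univ.filter (fun i : Fin n => x i ≠ 0)).card = s) (hs : 1 ≤ s) :
    (psi1 ((s : ℝ) / n) - 2 / √((s : ℝ) * n) - 1 / (2 * (n : ℝ))
        ≤ statisticalDimension (priorRestrictedCone (l1BoundedNormProgram n) x) / n ∧
      statisticalDimension (priorRestrictedCone (l1BoundedNormProgram n) x) / n
        ≤ psi1 ((s : ℝ) / n)) ∧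
    (∀ ρ ∈ Set.Icc (0 : ℝ) 1, psi1 ρ ∈ Set.Icc (0 : ℝ) 1) ∧
    (∀ ρ ∈ Set.Ioc (0 : ℝ) 1, ∃ τ : ℝ, 0 ≤ τ ∧
      psi1Objective ρ τ = psi1 ρ ∧
      (∀ τ' : ℝ, 0 ≤ τ' → psi1Objective ρ τ' = psi1 ρ → τ' = τ) ∧
      (ρ < 1 → 0 < τ ∧ Psi1Stationary ρ τ ∧
        ∀ τ' : ℝ, 0 < τ' → Psi1Stationary ρ τ' → τ' = τ)) := by
  refine ⟨?_, fun ρ hρ => psi1_mem_Icc hρ, fun ρ hρ => psi1_minimizer hρ⟩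
  have hs' : (0 : ℝ) < s := by positivity
  have hsn := natCast_le_of_card hx
  have hn : (0 : ℝ) < n := hs'.trans_le hsn
  have hρ : (s : ℝ) / n ∈ Set.Ioc (0 : ℝ) 1 := ⟨by positivity, (div_le_one hn).2 hsn⟩
  constructor
  · obtain ⟨τ, hτ, hst, hpos⟩ := exists_stationary hρ
    have h : s * τ = (n - s : ℝ) * excessMoment 1 τ := by
      field_simp at hst
      linarith
    have h1 := le_statisticalDimension_l1Cone hs hx hn.ne' hτ h
    rw [psi1_eq_of_stationary ⟨hρ.1.le, hρ.2⟩ hτ hst] at h1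
    have h2 := variance_bound hs hsn hτ (fun hlt => hpos ((div_lt_one hn).2 hlt)) h
    have h3 : √((n : ℝ) / s) = n / √((s : ℝ) * n) := by
      rw [eq_div_iff (by positivity), ← Real.sqrt_mul (by positivity),
        show (n : ℝ) / s * (s * n) = n ^ 2 by field_simp, Real.sqrt_sq hn.le]
    rw [h3] at h2
    rw [le_div_iff₀ hn]
    have h4 : (psi1 ((s : ℝ) / n) - 2 / √((s : ℝ) * n) - 1 / (2 * (n : ℝ))) * n
        = n * psi1 ((s : ℝ) / n) - 2 * (n / √((s : ℝ) * n)) - 1 / 2 := by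
      field_simp
    rw [h4]
    linarith
  · refine le_psi1 fun τ hτ => ?_
    rw [div_le_iff₀ hn, mul_comm]
    exact statisticalDimension_l1Cone_le hx hn.ne' hτ
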